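/- For probability measures $P,Q$ on a common measurable space and $\alpha\ge 0$ let \[H_\alpha(P\|Q)=\mathbb E_{\omega\sim Q}\Big[\Big(\frac{dP}{dQ}(\omega)-\alpha\Big)_+\Big]+P_s(\Omega)\] be the hockey-stick divergence, where $dP/dQ$ is the density of the part of $P$ that is absolutely continuous with respect to $Q$, and $P_s$ is the part of $P$ that is singular to $Q$ (equivalently, $H_\alpha(P\|Q)=\int (p-\alpha q)_+\,d\mu$ if $P,Q$ have densities $p,q$ with respect to a common dominating $\sigma$-finite measure $\mu$). Let $\mathcal H$ be the set of all functions $H:[0,\infty)\to\mathbb R$ that are convex and decreasing (in the weak sense) and satisfy $H(0)=1$ and $H(x)\ge (1-x)_+$ for all $x\ge 0$. Then for every function $H:[0,\infty)\to\mathbb R$, there exist probability measures $P,Q$ on some common measurable space such that $H(\alpha)=H_\alpha(P\|Q)$ for all $\alpha\ge 0$ if and only if $H\in\mathcal H$. Moreover, if $H\in\mathcal H$, such a pair is given explicitly as follows: $Q$ is the uniform distribution on $[0,1]$, and $P$ is the probability measure on $\mathbb R$ whose cumulative distribution function is \[F_P(x)=\begin{cases}0,& x<0,\\ 1+H^*(x-1),&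 0\le x<1,\\ 1,& x\ge 1,\end{cases}\] where $H^*(y)=\sup_{z\ge 0}\,(yz-H(z))$ is the Fenchel conjugate of $H$. (In particular such a $P$ exists, and it may have an atom at $1$.) -/

import Mathlib

open MeasureTheory ProbabilityTheory
open scoped NNReal

/-- The hockey-stick divergence `H_α(P‖Q) = E_{ω ∼ Q}[(dP/dQ(ω) - α)_+]`. The density ratio `dP/dQ`
is understood to be `∞` on the part of the space where `P` is singular to `Q`; that part contributes
its `P`-mass. Equivalently, `H_α(P‖Q) = ∫ (p - α q)_+ dμ` for the densities `p`, `q` of `P`, `Q`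
with respect to any common dominating measure `μ`. -/
noncomputable def hockeyStick {Ω : Type*} [MeasurableSpace Ω] (α : ℝ) (P Q : Measure Ω) : ℝ :=
  ∫ ω, max ((P.rnDeriv Q ω).toReal - α) 0 ∂Q + (P.singularPart Q).real Set.univ

/-- For `P ≪ Q` the hockey-stick divergence is the expectation `E_Q[(dP/dQ - α)_+]`. -/
theorem hockeyStick_of_absolutelyContinuous {Ω : Type*} [MeasurableSpace Ω] (α : ℝ)
    (P Q : Measure Ω) (h : P ≪ Q) :
    hockeyStick α P Q = ∫ ω, max ((P.rnDeriv Q ω).toReal - α) 0 ∂Q := by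
  simp [hockeyStick, Measure.singularPart_eq_zero_of_ac h]

/-- The Fenchel conjugate `H^*(y) = sup_{z ≥ 0} (y z - H(z))`, with values in `[-∞, ∞]`, of a
function on `[0, ∞)` (extended by `+∞` to the negative numbers). -/
noncomputable def fenchelConj (H : ℝ≥0 → ℝ) (y : ℝ) : EReal :=
  ⨆ z : ℝ≥0, ((y * (z : ℝ) - H z : ℝ) : EReal)

/-- The class of functions `H : [0, ∞) → ℝ` that are convex, decreasing (in the weak sense), and
satisfy `H(0) = 1` and `H(x) ≥ (1 - x)_+`. -/
def hockeyStickClass : Set (ℝ≥0 → ℝ) :=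
  {H | ConvexOn ℝ≥0 Set.univ H ∧ Antitone H ∧ H 0 = 1 ∧ ∀ x : ℝ≥0, max (1 - (x : ℝ)) 0 ≤ H x}

/-- The uniform distribution on `[0, 1]`, as a measure on the real line. -/
noncomputable def uniform01 : Measure ℝ := volume.restrict (Set.Icc 0 1)

open Set Filter Topology

/-! ### Hockey-stick divergences: computation, transport, membership in the class. -/

section HockeyStick

variable {Ω Ω' : Type*} [MeasurableSpace Ω] [MeasurableSpace Ω']

/-! Every divergence curve lies in the class because `α ↦ (p - α)_+` is convex and decreasing
pointwise. Conversely, put `G(x) = 1 + H^*(x - 1)`. On `(-∞, 1]` it is convex, continuous and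
nondecreasing, zero for `x ≤ 0`, with `G(1) ≤ 1`. Let `P` have density `g = G'` (right derivative)
on `[0, 1]` and an atom of mass `1 - G(1)` at `1`. If `x - 1` is a subgradient of `H` at `α`, then
`G(x) = 1 + (x - 1)α - H(α)` and `α` is a subgradient of `G` at `x`, so `g - α` changes sign at `x`.
Hence `∫ (g - α)_+ = G(1) - G(x) - α(1 - x)`, and adding the atom leaves `H(α)`
(`integral_max_conjDensity_sub`). -/

theorem hockeyStick_withDensity_add (α : ℝ) {Q S : Measure Ω} [SigmaFinite Q]
    {f : Ω → ENNReal} (hf : Measurable f) (hS : S ⟂ₘ Q) :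
    hockeyStick α (Q.withDensity f + S) Q =
      ∫ ω, max ((f ω).toReal - α) 0 ∂Q + S.real univ := by
  have h1 : S = (Q.withDensity f + S).singularPart Q :=
    Measure.eq_singularPart hf hS (add_comm _ _)
  have h2 : f =ᵐ[Q] (Q.withDensity f + S).rnDeriv Q :=
    Measure.eq_rnDeriv hf hS (add_comm _ _)
  rw [hockeyStick, ← h1]
  congr 1
  refine integral_congr_ae ?_
  filter_upwards [h2] with ω hω
  rw [hω]

/-- Needed to move the construction from `ℝ` to `ULift ℝ`, since the main theorem allows `Ω` in any
universe. -/
theorem hockeyStick_map_measurableEquiv (α : ℝ) (e : Ω ≃ᵐ Ω') (P Q : Measure Ω)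
    [SigmaFinite P] [SigmaFinite Q] :
    hockeyStick α (P.map e) (Q.map e) = hockeyStick α P Q := by
  have : SigmaFinite (Q.map e) := e.sigmaFinite_map
  have hd : P.map e =
      (Q.map e).withDensity (P.rnDeriv Q ∘ e.symm) + (P.singularPart Q).map e := by
    conv_lhs => rw [← Measure.rnDeriv_add_singularPart P Q]
    rw [Measure.map_add _ _ e.measurable]
    congr 1
    ext s hs
    rw [Measure.map_apply e.measurable hs, withDensity_apply _ (e.measurable hs),
      withDensity_apply _ hs, e.measurableEmbedding.restrict_map, e.measurableEmbedding.lintegral_map]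
    simp
  have hs : (P.singularPart Q).map e ⟂ₘ Q.map e := by
    obtain ⟨s, hs, h1, h2⟩ := Measure.mutuallySingular_singularPart P Q
    refine ⟨e.symm ⁻¹' s, e.symm.measurable hs, ?_, ?_⟩
    · rw [Measure.map_apply e.measurable (e.symm.measurable hs)]
      simpa [← preimage_comp] using h1
    · rw [Measure.map_apply e.measurable (e.symm.measurable hs).compl]
      simpa [← preimage_comp, preimage_compl] using h2
  rw [hd, hockeyStick_withDensity_add α
    ((Measure.measurable_rnDeriv P Q).comp e.symm.measurable) hs, hockeyStick,
    e.measurableEmbedding.integral_map]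
  simp [measureReal_def, Measure.map_apply e.measurable MeasurableSet.univ]

theorem integrable_max_rnDeriv_sub (α : ℝ) (P Q : Measure Ω) [IsFiniteMeasure P]
    [IsFiniteMeasure Q] : Integrable (fun ω => max ((P.rnDeriv Q ω).toReal - α) 0) Q :=
  (Measure.integrable_toReal_rnDeriv.sub (integrable_const α)).pos_part

theorem integral_rnDeriv_add_singularPart_real (P Q : Measure Ω) [IsProbabilityMeasure P]
    [IsFiniteMeasure Q] :
    ∫ ω, (P.rnDeriv Q ω).toReal ∂Q + (P.singularPart Q).real univ = 1 := by
  rw [Measure.integral_toReal_rnDeriv']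
  simp

theorem hockeyStick_mem_hockeyStickClass (P Q : Measure Ω) [IsProbabilityMeasure P]
    [IsProbabilityMeasure Q] :
    (fun α : ℝ≥0 => hockeyStick (α : ℝ) P Q) ∈ hockeyStickClass := by
  have hint := fun α : ℝ => integrable_max_rnDeriv_sub α P Q
  have hone := integral_rnDeriv_add_singularPart_real P Q
  refine ⟨⟨convex_univ, fun x _ y _ a b _ _ hab => ?_⟩, fun x y hxy => ?_, ?_, fun x => ?_⟩
  · have hab' : (a : ℝ) + b = 1 := by exact_mod_cast hab
    have key : ∫ ω, max ((P.rnDeriv Q ω).toReal - (a * x + b * y : ℝ)) 0 ∂Q ≤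
        a * ∫ ω, max ((P.rnDeriv Q ω).toReal - (x : ℝ)) 0 ∂Q +
        b * ∫ ω, max ((P.rnDeriv Q ω).toReal - (y : ℝ)) 0 ∂Q := by
      rw [← integral_const_mul, ← integral_const_mul,
        ← integral_add ((hint _).const_mul _) ((hint _).const_mul _)]
      refine integral_mono (hint _) (((hint _).const_mul _).add ((hint _).const_mul _))
        fun ω => ?_
      set p := (P.rnDeriv Q ω).toReal
      have hp : p = a * p + b * p := by rw [← add_mul, hab', one_mul]
      have ha := a.coe_nonneg
      have hb := b.coe_nonneg
      refine max_le ?_ (by positivity)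
      nlinarith [mul_le_mul_of_nonneg_left (le_max_left (p - x) 0) ha,
        mul_le_mul_of_nonneg_left (le_max_left (p - y) 0) hb]
    simp only [hockeyStick, smul_eq_mul, NNReal.smul_def, NNReal.coe_add, NNReal.coe_mul]
    linear_combination key - (P.singularPart Q).real univ * hab'
  · refine add_le_add_left (integral_mono (hint _) (hint _) fun ω => ?_) _
    have : (x : ℝ) ≤ y := by exact_mod_cast hxy
    exact max_le_max_right _ (by linarith)
  · rw [← hone]
    simp [hockeyStick]
  · refine max_le ?_ (add_nonneg (integral_nonneg fun ω => le_max_right _ _) measureReal_nonneg)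
    have : ∫ ω, ((P.rnDeriv Q ω).toReal - (x : ℝ)) ∂Q ≤
        ∫ ω, max ((P.rnDeriv Q ω).toReal - (x : ℝ)) 0 ∂Q :=
      integral_mono (Measure.integrable_toReal_rnDeriv.sub (integrable_const _)) (hint _)
        fun ω => le_max_left _ _
    rw [integral_sub Measure.integrable_toReal_rnDeriv (integrable_const _)] at this
    simp only [integral_const, probReal_univ, smul_eq_mul, one_mul] at this
    simp only [hockeyStick]
    linarith

end HockeyStick

/-! ### Subgradients of `H`. -/

theorem exists_subgradient_of_mem_hockeyStickClass {H : ℝ≥0 → ℝ} (hH : H ∈ hockeyStickClass)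
    (α : ℝ≥0) :
    ∃ s : ℝ, -1 ≤ s ∧ s ≤ 0 ∧ ∀ z : ℝ≥0, H α + s * ((z : ℝ) - α) ≤ H z := by
  obtain ⟨hconv, hanti, h0, hlow⟩ := hH
  rcases eq_or_ne α 0 with rfl | hα
  -- At the endpoint `0` one-sided derivatives are not used: `H z ≥ 1 - z` is itself the supporting
  -- line.
  · refine ⟨-1, le_rfl, by norm_num, fun z => ?_⟩
    have := (le_max_left _ _).trans (hlow z)
    simp only [h0, NNReal.coe_zero]
    linarith
  have hα' : (0 : ℝ) < α := by positivity
  set h : ℝ → ℝ := fun t => H t.toNNReal with hh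
  have hc : ConvexOn ℝ (Ici 0) h := by
    refine ⟨convex_Ici 0, fun x hx y hy a b ha hb hab => ?_⟩
    have := hconv.2 (mem_univ x.toNNReal) (mem_univ y.toNNReal) (zero_le (a := a.toNNReal))
      (zero_le (a := b.toNNReal)) (by rw [← Real.toNNReal_add ha hb, hab, Real.toNNReal_one])
    simp only [NNReal.smul_def, smul_eq_mul, Real.coe_toNNReal _ ha, Real.coe_toNNReal _ hb,
      ← Real.toNNReal_mul ha, ← Real.toNNReal_mul hb] at this
    rwa [← Real.toNNReal_add (mul_nonneg ha hx) (mul_nonneg hb hy)] at this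
  have hint : (α : ℝ) ∈ interior (Ici (0 : ℝ)) := by simpa using hα'
  set s := derivWithin h (Ioi (α : ℝ)) α
  have key : ∀ z : ℝ≥0, H α + s * ((z : ℝ) - α) ≤ H z := by
    intro z
    rcases lt_trichotomy (z : ℝ) α with hz | hz | hz
    · have h1 := (hc.slope_le_leftDeriv_of_mem_interior (x := z) z.coe_nonneg hint hz).trans
        (hc.leftDeriv_le_rightDeriv_of_mem_interior hint)
      rw [slope_def_field, div_le_iff₀ (by linarith)] at h1
      simp only [hh, Real.toNNReal_coe] at h1
      linarith
    · have : z = α := by exact_mod_cast hz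
      simp [this]
    · have h1 := hc.rightDeriv_le_slope_of_mem_interior (y := z) hint z.coe_nonneg hz
      rw [slope_def_field, le_div_iff₀ (by linarith)] at h1
      simp only [hh, Real.toNNReal_coe] at h1
      linarith
  refine ⟨s, ?_, ?_, key⟩
  -- The supporting line at `0` gives `H α - s α ≤ 1`, while `H α ≥ 1 - α`; so `-s α ≤ α`.
  · have h1 := key 0
    have h2 := (le_max_left _ _).trans (hlow α)
    simp only [h0, NNReal.coe_zero] at h1
    nlinarith
  · have h1 := key (α + 1)
    have h2 := hanti (le_self_add : α ≤ α + 1)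
    push_cast at h1
    linarith

/-! ### The conjugate `G = conjCdf H` on `(-∞, 1]`. -/

/-- The real-valued version of `1 + H^*(x - 1)`, meaningful for `x ≤ 1`. -/
noncomputable def conjCdf (H : ℝ≥0 → ℝ) (x : ℝ) : ℝ :=
  1 + ⨆ z : ℝ≥0, ((x - 1) * (z : ℝ) - H z)

section ConjCdf

variable {H : ℝ≥0 → ℝ}

theorem bddAbove_range_conjCdf (hH : H ∈ hockeyStickClass) {x : ℝ} (hx : x ≤ 1) :
    BddAbove (range fun z : ℝ≥0 => (x - 1) * (z : ℝ) - H z) := by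
  refine ⟨0, ?_⟩
  rintro _ ⟨z, rfl⟩
  have := (le_max_right _ _).trans (hH.2.2.2 z)
  have := z.coe_nonneg
  simp only
  nlinarith

theorem le_conjCdf (hH : H ∈ hockeyStickClass) {x : ℝ} (hx : x ≤ 1) (z : ℝ≥0) :
    1 + ((x - 1) * (z : ℝ) - H z) ≤ conjCdf H x :=
  add_le_add_right (le_ciSup (bddAbove_range_conjCdf hH hx) z) 1

theorem conjCdf_le {x y : ℝ} (h : ∀ z : ℝ≥0, 1 + ((x - 1) * (z : ℝ) - H z) ≤ y) :
    conjCdf H x ≤ y := by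
  have : ⨆ z : ℝ≥0, ((x - 1) * (z : ℝ) - H z) ≤ y - 1 := ciSup_le fun z => by linarith [h z]
  rw [conjCdf]
  linarith

theorem coe_conjCdf (hH : H ∈ hockeyStickClass) {x : ℝ} (hx : x ≤ 1) :
    ((conjCdf H x : ℝ) : EReal) = 1 + fenchelConj H (x - 1) := by
  rw [conjCdf, EReal.coe_add, EReal.coe_one]
  congr 1
  have hb := bddAbove_range_conjCdf hH hx
  refine le_antisymm ?_ (iSup_le fun z => EReal.coe_le_coe_iff.2 (le_ciSup hb z))
  refine EReal.le_of_forall_lt_iff_le.1 fun r hr => ?_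
  refine EReal.coe_le_coe_iff.2 (ciSup_le fun z => ?_)
  exact EReal.coe_le_coe_iff.1 ((le_iSup (fun z : ℝ≥0 => (((x - 1) * (z : ℝ) - H z : ℝ) : EReal))
    z).trans hr.le)

theorem conjCdf_monotoneOn (hH : H ∈ hockeyStickClass) : MonotoneOn (conjCdf H) (Iic 1) := fun x _ y hy hxy =>
  conjCdf_le fun z => le_trans (by gcongr) (le_conjCdf hH hy z)

theorem conjCdf_of_nonpos (hH : H ∈ hockeyStickClass) {x : ℝ} (hx : x ≤ 0) : conjCdf H x = 0 := by
  refine le_antisymm (conjCdf_le fun z => ?_) ?_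
  · have := (le_max_left _ _).trans (hH.2.2.2 z)
    nlinarith [z.coe_nonneg]
  · have := le_conjCdf hH (x := x) (by linarith) 0
    simpa [hH.2.2.1] using this

theorem conjCdf_one_le (hH : H ∈ hockeyStickClass) : conjCdf H 1 ≤ 1 := conjCdf_le fun z => by
  have := (le_max_right _ _).trans (hH.2.2.2 z)
  linarith

theorem conjCdf_convexOn (hH : H ∈ hockeyStickClass) : ConvexOn ℝ (Iic 1) (conjCdf H) := by
  refine ⟨convex_Iic 1, fun x hx y hy a b ha hb hab => conjCdf_le fun z => ?_⟩
  have h1 := mul_le_mul_of_nonneg_left (le_conjCdf hH hx z) ha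
  have h2 := mul_le_mul_of_nonneg_left (le_conjCdf hH hy z) hb
  obtain rfl : b = 1 - a := by linarith
  simp only [smul_eq_mul]
  linarith

/-- Convexity gives continuity below `1`. At `1`, a supremum of continuous functions is lower
semicontinuous, and monotonicity gives the upper bound. -/
theorem conjCdf_continuousOn (hH : H ∈ hockeyStickClass) : ContinuousOn (conjCdf H) (Iic 1) := by
  intro x hx
  rcases eq_or_lt_of_le (show x ≤ 1 from hx) with rfl | hx
  · refine tendsto_order.2 ⟨fun a ha => ?_, fun a ha => ?_⟩
    · obtain ⟨z, hz⟩ : ∃ z : ℝ≥0, a < 1 + (((1 : ℝ) - 1) * (z : ℝ) - H z) := by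
        by_contra! h
        exact absurd (conjCdf_le h) (not_le.2 ha)
      have hc : Tendsto (fun x : ℝ => 1 + ((x - 1) * (z : ℝ) - H z)) (𝓝[Iic 1] 1)
          (𝓝 (1 + (((1 : ℝ) - 1) * (z : ℝ) - H z))) :=
        (Continuous.tendsto (by fun_prop) _).mono_left nhdsWithin_le_nhds
      filter_upwards [hc.eventually (lt_mem_nhds hz), self_mem_nhdsWithin] with y hy hy1
      exact hy.trans_le (le_conjCdf hH hy1 z)
    · filter_upwards [self_mem_nhdsWithin] with y hy
      exact (conjCdf_monotoneOn hH hy self_mem_Iic hy).trans_lt ha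
  · have h := (conjCdf_convexOn hH).continuousOn_interior
    rw [interior_Iic] at h
    exact (h.continuousAt (Iio_mem_nhds hx)).continuousWithinAt

end ConjCdf

/-! ### The density `g` and its integrals. -/

/-- The density on `[0, 1)` of the measure with cumulative distribution function `conjCdf H`. -/
noncomputable def conjDensity (H : ℝ≥0 → ℝ) (x : ℝ) : ℝ :=
  derivWithin (conjCdf H) (Ioi x) x

theorem measurable_conjDensity (H : ℝ≥0 → ℝ) : Measurable (conjDensity H) :=
  measurable_derivWithin_Ioi _

section ConjDensity

variable {H : ℝ≥0 → ℝ}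

theorem hasDerivWithinAt_conjDensity (hH : H ∈ hockeyStickClass) {x : ℝ} (hx : x < 1) :
    HasDerivWithinAt (conjCdf H) (conjDensity H x) (Ioi x) x :=
  (conjCdf_convexOn hH).hasDerivWithinAt_rightDeriv_of_mem_interior (by simpa using hx)

/-- With `conjDensity_mul_le`, this makes the density a subgradient of `conjCdf H`. -/
theorem le_conjDensity_mul (hH : H ∈ hockeyStickClass) {x y : ℝ} (hyx : y < x) (hx : x < 1) :
    conjCdf H x - conjCdf H y ≤ conjDensity H x * (x - y) := by
  have hint : x ∈ interior (Iic (1 : ℝ)) := by simpa using hx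
  have h := ((conjCdf_convexOn hH).slope_le_leftDeriv_of_mem_interior (x := y)
    (hyx.trans hx).le hint hyx).trans
      ((conjCdf_convexOn hH).leftDeriv_le_rightDeriv_of_mem_interior hint)
  rwa [slope_def_field, div_le_iff₀ (by linarith)] at h

theorem conjDensity_mul_le (hH : H ∈ hockeyStickClass) {x y : ℝ} (hxy : x < y) (hy : y ≤ 1) :
    conjDensity H x * (y - x) ≤ conjCdf H y - conjCdf H x := by
  have hint : x ∈ interior (Iic (1 : ℝ)) := by simpa using hxy.trans_le hy
  have h := (conjCdf_convexOn hH).rightDeriv_le_slope_of_mem_interior (y := y) hint hy hxy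
  rwa [slope_def_field, le_div_iff₀ (by linarith)] at h

theorem conjDensity_nonneg (hH : H ∈ hockeyStickClass) {x : ℝ} (hx : x < 1) : 0 ≤ conjDensity H x := by
  have h1 := le_conjDensity_mul hH (sub_one_lt x) hx
  have h2 := conjCdf_monotoneOn hH (show x - 1 ≤ 1 by linarith) hx.le (sub_one_lt x).le
  linarith

theorem integrableOn_conjDensity (hH : H ∈ hockeyStickClass) {a b : ℝ} (hb : b ≤ 1) :
    IntegrableOn (conjDensity H) (Ioc a b) :=
  intervalIntegral.integrableOn_deriv_right_of_nonneg
    ((conjCdf_continuousOn hH).mono fun _ hx => hx.2.trans hb)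
    (fun _ hx => hasDerivWithinAt_conjDensity hH (hx.2.trans_le hb))
    fun _ hx => conjDensity_nonneg hH (hx.2.trans_le hb)

theorem integral_conjDensity (hH : H ∈ hockeyStickClass) {a b : ℝ} (hab : a ≤ b) (hb : b ≤ 1) :
    ∫ x in a..b, conjDensity H x = conjCdf H b - conjCdf H a :=
  intervalIntegral.integral_eq_sub_of_hasDeriv_right_of_le hab
    ((conjCdf_continuousOn hH).mono fun _ hx => hx.2.trans hb)
    (fun _ hx => hasDerivWithinAt_conjDensity hH (hx.2.trans_le hb))
    ((intervalIntegrable_iff_integrableOn_Ioc_of_le hab).2 (integrableOn_conjDensity hH hb))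

/-- The form of `hsx` covers both half-lines `Iic x` and sets containing all of `[0, 1]`. -/
theorem withDensity_conjDensity_apply (hH : H ∈ hockeyStickClass) {s : Set ℝ} (hs : MeasurableSet s) {x : ℝ} (h0 : 0 ≤ x)
    (h1 : x ≤ 1) (hsx : s ∩ Icc 0 1 = Icc 0 x) :
    uniform01.withDensity (fun y => ENNReal.ofReal (conjDensity H y)) s =
      ENNReal.ofReal (conjCdf H x) := by
  rw [withDensity_apply _ hs, uniform01, Measure.restrict_restrict hs, hsx,
    ← restrict_Ioc_eq_restrict_Icc, ← ofReal_integral_eq_lintegral_ofReal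
      (integrableOn_conjDensity hH h1),
    ← intervalIntegral.integral_of_le h0, integral_conjDensity hH h0 h1,
    conjCdf_of_nonpos hH le_rfl, sub_zero]
  -- Nonnegativity of the density is available only below `1`, so the null endpoint is dropped.
  rw [← restrict_Ioo_eq_restrict_Ioc]
  exact (ae_restrict_mem measurableSet_Ioo).mono fun y hy =>
    conjDensity_nonneg hH (hy.2.trans_le h1)

theorem integral_max_conjDensity_sub (hH : H ∈ hockeyStickClass) (α : ℝ≥0) :
    ∫ x, max (conjDensity H x - α) 0 ∂uniform01 + (1 - conjCdf H 1) = H α := by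
  obtain ⟨s, hs1, hs0, hs⟩ := exists_subgradient_of_mem_hockeyStickClass hH α
  obtain ⟨x, rfl⟩ : ∃ x, s = x - 1 := ⟨s + 1, by ring⟩
  have hx0 : 0 ≤ x := by linarith
  have hx1 : x ≤ 1 := by linarith
  -- Equality in Fenchel's inequality: the subgradient property says that `z = α` attains the
  -- supremum.
  have hGx : conjCdf H x = 1 + ((x - 1) * α - H α) :=
    le_antisymm (conjCdf_le fun z => by linarith [hs z]) (le_conjCdf hH hx1 α)
  -- Dually, `α` is a subgradient of `conjCdf H` at `x`; hence the density is at most `α` left of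
  -- `x` and at least `α` right of it.
  have hsub : ∀ y ≤ 1, conjCdf H x + α * (y - x) ≤ conjCdf H y := fun y hy => by
    linarith [le_conjCdf hH hy α]
  have hae : (fun y => max (conjDensity H y - α) 0) =ᵐ[volume.restrict (Ioc 0 1)]
      (Ioc x 1).indicator fun y => conjDensity H y - α := by
    rw [← restrict_Ioo_eq_restrict_Ioc]
    have hne : ∀ᵐ y ∂(volume.restrict (Ioo (0 : ℝ) 1)), y ≠ x :=
      ae_restrict_of_ae (Measure.ae_ne volume x)
    filter_upwards [ae_restrict_mem measurableSet_Ioo, hne] with y hy hyx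
    rcases lt_or_gt_of_ne hyx with h | h
    · rw [indicator_of_notMem (fun h' => h.not_gt h'.1)]
      have h1 := conjDensity_mul_le hH h hx1
      have h2 := hsub y hy.2.le
      refine max_eq_right ?_
      nlinarith
    · rw [indicator_of_mem (show y ∈ Ioc x 1 from ⟨h, hy.2.le⟩)]
      have h1 := le_conjDensity_mul hH h hy.2
      have h2 := hsub y hy.2.le
      refine max_eq_left ?_
      nlinarith
  rw [uniform01, ← restrict_Ioc_eq_restrict_Icc, integral_congr_ae hae,
    setIntegral_indicator measurableSet_Ioc,
    inter_eq_right.2 (Ioc_subset_Ioc_left hx0), integral_sub (integrableOn_conjDensity hH le_rfl)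
      (integrable_const _), ← intervalIntegral.integral_of_le hx1,
    integral_conjDensity hH hx1 le_rfl, hGx]
  simp only [integral_const, measureReal_restrict_apply_univ, Real.volume_real_Ioc_of_le hx1,
    smul_eq_mul]
  ring

end ConjDensity

instance isProbabilityMeasure_uniform01 : IsProbabilityMeasure uniform01 :=
  ⟨by simp [uniform01]⟩

/-! ### The measure `P`, its divergence from the uniform law and its distribution function. -/

/-- The probability measure on `[0, 1]` with cumulative distribution function `conjCdf H` on
`[0, 1)`, with the remaining mass at `1`. -/
noncomputable def conjMeasure (H : ℝ≥0 → ℝ) : Measure ℝ :=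
  uniform01.withDensity (fun y => ENNReal.ofReal (conjDensity H y)) +
    ENNReal.ofReal (1 - conjCdf H 1) • Measure.dirac 1

section ConjMeasure

variable {H : ℝ≥0 → ℝ}

theorem conjMeasure_apply_of_lt_one (hH : H ∈ hockeyStickClass) {s : Set ℝ} (hs : MeasurableSet s) {x : ℝ} (h0 : 0 ≤ x)
    (h1 : x < 1) (hsx : s ∩ Icc 0 1 = Icc 0 x) :
    conjMeasure H s = ENNReal.ofReal (conjCdf H x) := by
  have : (1 : ℝ) ∉ s := fun h => by
    have : (1 : ℝ) ∈ Icc 0 x := hsx ▸ ⟨h, by simp⟩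
    exact h1.not_ge this.2
  simp [conjMeasure, withDensity_conjDensity_apply hH hs h0 h1.le hsx, hs, this]

theorem conjMeasure_apply_of_Icc_subset (hH : H ∈ hockeyStickClass) {s : Set ℝ} (hs : MeasurableSet s)
    (hsub : Icc 0 1 ⊆ s) : conjMeasure H s = 1 := by
  have h1 : (1 : ℝ) ∈ s := hsub (by simp)
  have h0 : 0 ≤ conjCdf H 1 := by
    rw [← conjCdf_of_nonpos hH le_rfl]
    exact conjCdf_monotoneOn hH (by simp) (by simp) zero_le_one
  simp [conjMeasure, withDensity_conjDensity_apply hH hs zero_le_one le_rfl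
    (inter_eq_right.2 hsub), hs, h1]
  rw [← ENNReal.ofReal_add h0 (sub_nonneg.2 (conjCdf_one_le hH))]
  simp

theorem isProbabilityMeasure_conjMeasure (hH : H ∈ hockeyStickClass) : IsProbabilityMeasure (conjMeasure H) :=
  ⟨conjMeasure_apply_of_Icc_subset hH MeasurableSet.univ (subset_univ _)⟩

theorem hockeyStick_conjMeasure (hH : H ∈ hockeyStickClass) (α : ℝ≥0) :
    hockeyStick (α : ℝ) (conjMeasure H) uniform01 = H α := by
  have hS : ENNReal.ofReal (1 - conjCdf H 1) • Measure.dirac (1 : ℝ) ⟂ₘ uniform01 := by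
    refine Measure.MutuallySingular.smul _ ⟨{1}ᶜ, (measurableSet_singleton _).compl, ?_, ?_⟩
    · simp
    · simp [uniform01]
  rw [conjMeasure, hockeyStick_withDensity_add _ (measurable_conjDensity H).ennreal_ofReal hS,
    ← integral_max_conjDensity_sub hH α]
  congr 1
  · rw [uniform01, ← restrict_Ioc_eq_restrict_Icc, ← restrict_Ioo_eq_restrict_Ioc]
    refine setIntegral_congr_fun measurableSet_Ioo fun y hy => ?_
    simp only [ENNReal.toReal_ofReal (conjDensity_nonneg hH hy.2)]
  · simp [measureReal_def, ENNReal.toReal_ofReal (sub_nonneg.2 (conjCdf_one_le hH))]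

theorem cdf_conjMeasure_of_neg (hH : H ∈ hockeyStickClass) {x : ℝ} (hx : x < 0) : cdf (conjMeasure H) x = 0 := by
  have := isProbabilityMeasure_conjMeasure hH
  have h1 := conjMeasure_apply_of_Icc_subset hH (s := Ioi x) measurableSet_Ioi
    fun y hy => hx.trans_le hy.1
  have h2 := (prob_compl_eq_zero_iff (μ := conjMeasure H) measurableSet_Ioi).2 h1
  rw [compl_Ioi] at h2
  rw [cdf_eq_real, measureReal_def, h2, ENNReal.toReal_zero]

theorem cdf_conjMeasure_of_mem_Ico (hH : H ∈ hockeyStickClass) {x : ℝ} (h0 : 0 ≤ x) (h1 : x < 1) :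
    cdf (conjMeasure H) x = conjCdf H x := by
  have := isProbabilityMeasure_conjMeasure hH
  have hx : 0 ≤ conjCdf H x := by
    rw [← conjCdf_of_nonpos hH le_rfl]
    exact conjCdf_monotoneOn hH (by simp) h1.le h0
  rw [cdf_eq_real, measureReal_def, conjMeasure_apply_of_lt_one hH measurableSet_Iic h0 h1,
    ENNReal.toReal_ofReal hx]
  ext y
  simp only [mem_inter_iff, mem_Iic, mem_Icc]
  exact ⟨fun h => ⟨h.2.1, h.1⟩, fun h => ⟨h.2, h.1, h.2.trans h1.le⟩⟩

theorem cdf_conjMeasure_of_one_le (hH : H ∈ hockeyStickClass) {x : ℝ} (hx : 1 ≤ x) : cdf (conjMeasure H) x = 1 := by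
  have := isProbabilityMeasure_conjMeasure hH
  rw [cdf_eq_real, measureReal_def, conjMeasure_apply_of_Icc_subset hH measurableSet_Iic
    fun y hy => hy.2.trans hx, ENNReal.toReal_one]

end ConjMeasure

theorem mainTheorem3 :
    (∀ H : ℝ≥0 → ℝ,
      (∃ (Ω : Type*) (_ : MeasurableSpace Ω) (P Q : Measure Ω),
        IsProbabilityMeasure P ∧ IsProbabilityMeasure Q ∧
          ∀ α : ℝ≥0, H α = hockeyStick (α : ℝ) P Q) ↔
      H ∈ hockeyStickClass) ∧
    (∀ H ∈ hockeyStickClass, ∃ P : Measure ℝ,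
      IsProbabilityMeasure P ∧
      (∀ x : ℝ, x < 0 → cdf P x = 0) ∧
      (∀ x : ℝ, 0 ≤ x → x < 1 → ((cdf P x : ℝ) : EReal) = 1 + fenchelConj H (x - 1)) ∧
      (∀ x : ℝ, 1 ≤ x → cdf P x = 1) ∧
      ∀ α : ℝ≥0, H α = hockeyStick (α : ℝ) P uniform01) := by
  refine ⟨fun H => ⟨?_, fun hH => ?_⟩, fun H hH => ?_⟩
  · rintro ⟨Ω, _, P, Q, hP, hQ, h⟩
    rw [funext h]
    exact hockeyStick_mem_hockeyStickClass P Q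
  · have := isProbabilityMeasure_conjMeasure hH
    let e : ℝ ≃ᵐ ULift ℝ := MeasurableEquiv.ulift.symm
    refine ⟨ULift ℝ, inferInstance, (conjMeasure H).map e, uniform01.map e,
      Measure.isProbabilityMeasure_map e.measurable.aemeasurable,
      Measure.isProbabilityMeasure_map e.measurable.aemeasurable, fun α => ?_⟩
    rw [hockeyStick_map_measurableEquiv, hockeyStick_conjMeasure hH]
  · exact ⟨conjMeasure H, isProbabilityMeasure_conjMeasure hH,
      fun x hx => cdf_conjMeasure_of_neg hH hx,
      fun x h0 h1 => by rw [cdf_conjMeasure_of_mem_Ico hH h0 h1, coe_conjCdf hH h1.le],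
      fun x hx => cdf_conjMeasure_of_one_le hH hx,
      fun α => (hockeyStick_conjMeasure hH α).symm⟩
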